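/- Let $G$ be a finite group and let $\varphi\colon G\to\mathbb{C}$ be a class function, i.e. a function constant on the conjugacy classes of $G$. A generalized character of a finite group $H$ is a $\mathbb{Z}$-linear combination of characters of irreducible complex representations of $H$. A linear character of $H$ is the character of a one-dimensional complex representation of $H$. A group is called elementary if, for some prime $p$, it is the direct product of a cyclic group and a $p$-group. For a linear character $\lambda$ of a subgroup $E\le G$, $\lambda^G$ denotes the induced character, i.e. the character of the representation of $G$ induced from the representation of $E$ affording $\lambda$. Then the following conditions are equivalent: (i) $\varphi$ is a generalized character of $G$; (ii) for every elementary subgroup $E\le G$, the restriction $\varphi|_E$ is a generalized character of $E$; (iii) $\varphi$ is a $\mathbb{Z}$-linear combination of characters of the form $\lambda^G$, where $E$ runs over the elementary subgroups of $G$ and $\lambda$ over the linear characters of $E$. -/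

import Mathlib

/-- A class function on `G`: a complex valued function constant on conjugacy classes. -/
def IsClassFunction {G : Type*} [Group G] (φ : G → ℂ) : Prop :=
  ∀ g x : G, φ (x * g * x⁻¹) = φ g

/-- `Irr(G)`: the characters of the irreducible complex representations of `G`, each taken on a
space `ℂⁿ` of column vectors. -/
def irreducibleCharacters (G : Type*) [Group G] : Set (G → ℂ) :=
  {χ | ∃ (n : ℕ) (ρ : Representation ℂ G (Fin n → ℂ)), ρ.IsIrreducible ∧ χ = ρ.character}

/-- The generalized characters of `G`: the integer linear combinations of
characters of irreducible complex representations of `G`. -/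
def generalizedCharacters (G : Type*) [Group G] : Submodule ℤ (G → ℂ) :=
  Submodule.span ℤ (irreducibleCharacters G)

/-- A group is `p`-elementary if it is the (internal) direct product of a cyclic group `C` and a
`p`-group `P`. -/
def IsPElementary (p : ℕ) (E : Type*) [Group E] : Prop :=
  ∃ C P : Subgroup E, IsCyclic C ∧ IsPGroup p P ∧ IsCompl C P ∧
    ∀ c ∈ C, ∀ x ∈ P, c * x = x * c

/-- A group is (Brauer) elementary if it is `p`-elementary for some prime `p`. -/
def IsBrauerElementary (E : Type*) [Group E] : Prop :=
  ∃ p : ℕ, p.Prime ∧ IsPElementary p E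

/-- The character of `G` induced from the character of a representation `ρ` of a subgroup `H`,
that is, the character of the induced representation of `G`. -/
noncomputable def inducedCharacter {G : Type*} [Group G] (H : Subgroup G) {V : Type*}
    [AddCommGroup V] [Module ℂ V] (ρ : Representation ℂ H V) : G → ℂ :=
  (Representation.ind H.subtype ρ).character

/-- The characters of `G` induced from linear characters (that is, characters of one-dimensional
representations, taken on the space `ℂ`) of elementary subgroups of `G`. -/
def elementaryMonomialCharacters (G : Type*) [Group G] : Set (G → ℂ) :=
  {ψ | ∃ (E : Subgroup G) (ρ : Representation ℂ E ℂ),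
    IsBrauerElementary E ∧ ψ = inducedCharacter E ρ}

/-! The heart is Brauer's statement that the constant function `1` is a `ℤ`-combination of functions
induced from generalized characters of elementary subgroups
(`one_mem_span_elementaryInducedFunctions`). Given this, write `φ = φ * 1`. The projection formula
turns `φ * Ind θ` into `Ind (Res φ * θ)`, so (ii) expresses `φ` through characters induced from
elementary subgroups. These groups are nilpotent, so their characters are integer combinations of
monomial ones, and transitivity of induction gives (iii). The other implications hold because
restriction and induction preserve generalized characters.

For the constant `1`, coefficients are first enlarged to a cyclotomic ring `A`. Given `x` and a
prime `p`, let `c` be the `p`-regular part of `x` and `E` the product of `⟨c⟩` with a Sylow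
`p`-subgroup of the centralizer of `c`. Inducing from `E` a multiple of the indicator of the
elements with regular part `c` gives an integer prime to `p` at `x`, by counting fixed points
(`exists_isElementaryProjection`). Letting `p` vary gives a function with value `1` at `x`. As the
`A`-span is closed under products, these combine into the constant `1`. Finally `A` retracts
`ℤ`-linearly onto `ℤ`, and linear independence of the irreducible characters brings the coefficients
back to `ℤ` (`one_mem_span_int`). -/

open scoped Classical in
/-- The function on `G` induced from a function on `H` along a homomorphism `j : H →* G`. -/
noncomputable def inducedFunction {H G : Type*} [Group H] [Group G] [Finite H] [Finite G]
    (j : H →* G) : (H → ℂ) →ₗ[ℂ] (G → ℂ) :=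
  letI := Fintype.ofFinite H
  letI := Fintype.ofFinite G
  { toFun := fun f g ↦ (Nat.card H : ℂ)⁻¹ * ∑ y : G, ∑ h : H, if y * j h * y⁻¹ = g then f h else 0
    map_add' := fun f f' ↦ by
      ext g
      simp only [Pi.add_apply, ← mul_add, ← Finset.sum_add_distrib]
      refine congrArg _ (Finset.sum_congr rfl fun y _ ↦ Finset.sum_congr rfl fun h _ ↦ ?_)
      split_ifs <;> simp
    map_smul' := fun c f ↦ by
      ext g
      simp only [Pi.smul_apply, smul_eq_mul, RingHom.id_apply, Finset.mul_sum]
      congr! 2 with y _ h _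
      split_ifs <;> simp; ring }

/-! ### Induction of functions: transitivity and the projection formula. -/

section InducedFunction

variable {H G K : Type*} [Group H] [Group G] [Group K] [Finite H] [Finite G] [Finite K]

theorem inducedFunction_apply [Fintype H] [Fintype G] [DecidableEq G] (j : H →* G) (f : H → ℂ)
    (g : G) : inducedFunction j f g =
      (Nat.card H : ℂ)⁻¹ * ∑ y : G, ∑ h : H, if y * j h * y⁻¹ = g then f h else 0 := by
  simp only [inducedFunction, LinearMap.coe_mk, AddHom.coe_mk]
  congr!

/-- Translating `y` by `j z` absorbs the inner conjugation, leaving `|H|` equal sums that cancel one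
normalizing factor. -/
theorem inducedFunction_comp (i : K →* H) (j : H →* G) (f : K → ℂ) :
    inducedFunction j (inducedFunction i f) = inducedFunction (j.comp i) f := by
  classical
  have := Fintype.ofFinite H
  have := Fintype.ofFinite G
  have := Fintype.ofFinite K
  ext g
  simp only [inducedFunction_apply, MonoidHom.comp_apply]
  have hH : (Nat.card H : ℂ) ≠ 0 := by exact_mod_cast Nat.card_pos.ne'
  have key : ∀ y : G, (∑ h : H, if y * j h * y⁻¹ = g then (Nat.card K : ℂ)⁻¹ *
      ∑ z : H, ∑ k : K, (if z * i k * z⁻¹ = h then f k else 0) else 0) =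
      ∑ z : H, (Nat.card K : ℂ)⁻¹ *
        ∑ k : K, if (y * j z) * j (i k) * (y * j z)⁻¹ = g then f k else 0 := by
    intro y
    simp only [Finset.mul_sum]
    have : ∀ h : H, (if y * j h * y⁻¹ = g then ∑ z : H, ∑ k : K, (Nat.card K : ℂ)⁻¹ *
        (if z * i k * z⁻¹ = h then f k else 0) else 0) =
        ∑ z : H, ∑ k : K, if z * i k * z⁻¹ = h then
          (if y * j (z * i k * z⁻¹) * y⁻¹ = g then (Nat.card K : ℂ)⁻¹ * f k else 0) else 0 := by
      intro h
      split_ifs with hh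
      · congr! 2 with z _ k _
        split_ifs <;> simp_all
      · symm
        refine Finset.sum_eq_zero fun z _ ↦ Finset.sum_eq_zero fun k _ ↦ ?_
        split_ifs <;> simp_all
    simp only [this]
    rw [Finset.sum_comm]
    refine Finset.sum_congr rfl fun z _ ↦ ?_
    rw [Finset.sum_comm]
    refine Finset.sum_congr rfl fun k _ ↦ ?_
    rw [Finset.sum_ite_eq]
    simp [mul_assoc]
  simp only [key]
  rw [Finset.sum_comm]
  have key2 : ∀ z : H, (∑ y : G, (Nat.card K : ℂ)⁻¹ *
      ∑ k : K, if (y * j z) * j (i k) * (y * j z)⁻¹ = g then f k else 0) =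
      ∑ y : G, (Nat.card K : ℂ)⁻¹ * ∑ k : K, if y * j (i k) * y⁻¹ = g then f k else 0 := fun z ↦
    Fintype.sum_equiv (Equiv.mulRight (j z)) _ _ fun y ↦ rfl
  simp only [key2, Finset.sum_const, Finset.card_univ, ← Nat.card_eq_fintype_card, nsmul_eq_mul,
    ← Finset.mul_sum]
  rw [inv_mul_cancel_left₀ hH]

/-- The projection formula. -/
theorem mul_inducedFunction (j : H →* G) (φ : G → ℂ) (hφ : IsClassFunction φ) (f : H → ℂ) :
    φ * inducedFunction j f = inducedFunction j ((φ ∘ j) * f) := by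
  classical
  have := Fintype.ofFinite H
  have := Fintype.ofFinite G
  ext g
  simp only [Pi.mul_apply, inducedFunction_apply, Function.comp_apply]
  rw [mul_left_comm, Finset.mul_sum]
  congr! 2 with y _
  rw [Finset.mul_sum]
  congr! 1 with h _
  split_ifs with hh
  · rw [← hh, hφ]
  · simp

theorem inducedFunction_mulEquiv (e : K ≃* H) (f : H → ℂ) (j : H →* G) :
    inducedFunction (j.comp e.toMonoidHom) (f ∘ e) = inducedFunction j f := by
  classical
  have := Fintype.ofFinite H
  have := Fintype.ofFinite G
  have := Fintype.ofFinite K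
  ext g
  simp only [inducedFunction_apply, Nat.card_congr e.toEquiv]
  congr! 2 with y _
  exact Fintype.sum_equiv e.toEquiv _ _ fun h ↦ rfl

theorem inducedFunction_id (f : G → ℂ) (hf : IsClassFunction f) :
    inducedFunction (MonoidHom.id G) f = f := by
  classical
  have := Fintype.ofFinite G
  ext g
  rw [inducedFunction_apply]
  have : ∀ y : G, (∑ h : G, if y * (MonoidHom.id G) h * y⁻¹ = g then f h else 0) = f g := by
    intro y
    rw [Finset.sum_eq_single (y⁻¹ * g * y)]
    · simp only [MonoidHom.id_apply]
      rw [if_pos (by group)]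
      simpa using hf g y⁻¹
    · intro h _ hh
      rw [if_neg]
      rintro rfl
      apply hh
      simp only [MonoidHom.id_apply]; group
    · simp
  simp only [this, Finset.sum_const, Finset.card_univ, ← Nat.card_eq_fintype_card, nsmul_eq_mul]
  rw [inv_mul_cancel_left₀ (by exact_mod_cast Nat.card_pos.ne')]

end InducedFunction

/-! ### The character of an induced representation. -/

section Trace

open Representation

/-- The trace of the map induced on coinvariants, as an average of traces. -/
theorem trace_coinvariants_map {H V : Type*} [Group H] [Fintype H] [AddCommGroup V] [Module ℂ V]
    [FiniteDimensional ℂ V] (τ : Representation ℂ H V) (f : V →ₗ[ℂ] V)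
    (F : Coinvariants τ →ₗ[ℂ] Coinvariants τ)
    (hF : F ∘ₗ Coinvariants.mk τ = Coinvariants.mk τ ∘ₗ f) :
    LinearMap.trace ℂ _ F = (Nat.card H : ℂ)⁻¹ * ∑ h : H, LinearMap.trace ℂ V (τ h ∘ₗ f) := by
  have hH : (Nat.card H : ℂ) ≠ 0 := by exact_mod_cast Nat.card_pos.ne'
  let e : V →ₗ[ℂ] V := (Nat.card H : ℂ)⁻¹ • ∑ h : H, τ h
  have he : ∀ x : H, e ∘ₗ τ x = e := by
    intro x
    ext v
    simp only [e, LinearMap.comp_apply, LinearMap.smul_apply, LinearMap.sum_apply]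
    congr 1
    refine Fintype.sum_equiv (Equiv.mulRight x) _ _ fun h ↦ ?_
    simp
  -- Averaging over `H` splits the quotient map, so `F` factors through `f` and its trace can be
  -- computed on `V` by cyclicity.
  let s : Coinvariants τ →ₗ[ℂ] V := Coinvariants.lift τ e he
  have hs : s ∘ₗ Coinvariants.mk τ = e := by ext v; rfl
  have hq : Coinvariants.mk τ ∘ₗ s = LinearMap.id := by
    rw [← LinearMap.cancel_right (Coinvariants.mk_surjective τ), LinearMap.comp_assoc, hs]
    ext v
    simp only [e, LinearMap.comp_apply, LinearMap.smul_apply, LinearMap.sum_apply, map_smul,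
      map_sum, Coinvariants.mk_self_apply, Finset.sum_const, Finset.card_univ,
      ← Nat.card_eq_fintype_card, LinearMap.id_apply]
    rw [← Nat.cast_smul_eq_nsmul ℂ, smul_smul, inv_mul_cancel₀ hH, one_smul]
  have h1 : F = Coinvariants.mk τ ∘ₗ (f ∘ₗ s) := by
    rw [← LinearMap.comp_assoc, ← hF, LinearMap.comp_assoc, hq, LinearMap.comp_id]
  rw [h1, LinearMap.trace_comp_comm', LinearMap.comp_assoc, hs, LinearMap.trace_comp_comm']
  simp only [e, ← Module.End.mul_eq_comp]
  rw [smul_mul_assoc, map_smul, Finset.sum_mul, map_sum, smul_eq_mul]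

open scoped MonoidAlgebra in
theorem trace_mapDomain {G : Type*} [Fintype G] [DecidableEq G] (σ : G → G) :
    LinearMap.trace ℂ ℂ[G] (MonoidAlgebra.mapDomainLinearMap ℂ ℂ σ) =
      ∑ x : G, if σ x = x then 1 else 0 := by
  rw [LinearMap.trace_eq_matrix_trace ℂ (MonoidAlgebra.basis G ℂ)]
  simp [Matrix.trace, LinearMap.toMatrix_apply, Finsupp.single_apply, MonoidAlgebra.basis]

/-- The induced space is the `H`-coinvariants of `ℂ[G] ⊗ V`, so its trace is an average over `h`.
The `ℂ[G]` factor counts the fixed points of `x ↦ j h * (x * g⁻¹)`, which are matched with the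
conjugators `y = x⁻¹`. -/
theorem character_ind {H G V : Type*} [Group H] [Group G] [Finite H] [Finite G]
    [AddCommGroup V] [Module ℂ V] [FiniteDimensional ℂ V] (j : H →* G)
    (ρ : Representation ℂ H V) :
    (Representation.ind j ρ).character = inducedFunction j ρ.character := by
  classical
  have := Fintype.ofFinite H
  have := Fintype.ofFinite G
  have : FiniteDimensional ℂ (MonoidAlgebra ℂ G) := (MonoidAlgebra.basis G ℂ).finiteDimensional_of_finite
  ext g
  rw [Representation.character, inducedFunction_apply, trace_coinvariants_map _
    ((MonoidAlgebra.mapDomainLinearMap ℂ ℂ fun x => x * g⁻¹).rTensor V) _ rfl]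
  rw [Finset.sum_comm]
  congr! 2 with h _
  have h1 : (Representation.tprod ((leftRegular ℂ G).comp j) ρ) h ∘ₗ
      ((MonoidAlgebra.mapDomainLinearMap ℂ ℂ fun x => x * g⁻¹).rTensor V) =
      TensorProduct.map (MonoidAlgebra.mapDomainLinearMap ℂ ℂ fun x => j h * (x * g⁻¹)) (ρ h) := by
    ext; simp
  rw [h1, LinearMap.trace_tensorProduct', trace_mapDomain, Finset.sum_mul]
  refine Fintype.sum_equiv (Equiv.inv G) _ _ fun x ↦ ?_
  simp only [ite_mul, one_mul, zero_mul, Equiv.inv_apply, inv_inv, Representation.character]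
  refine if_congr ?_ rfl rfl
  rw [← mul_assoc, mul_inv_eq_iff_eq_mul, mul_assoc, inv_mul_eq_iff_eq_mul]

end Trace

/-! ### Generalized characters: closure properties and independence. -/

section Characters

open Representation

theorem Representation.isIrreducible_of_forall {G V : Type*} [Group G] [AddCommGroup V] [Module ℂ V]
    [Nontrivial V] (ρ : Representation ℂ G V)
    (h : ∀ W : Submodule ℂ V, (∀ g, ∀ v ∈ W, ρ g v ∈ W) → W = ⊥ ∨ W = ⊤) : ρ.IsIrreducible where
  exists_pair_ne := ⟨⊥, ⊤, fun e ↦ bot_ne_top (α := Submodule ℂ V)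
    (congrArg Subrepresentation.toSubmodule e)⟩
  eq_bot_or_eq_top W := (h W.toSubmodule W.apply_mem_toSubmodule).imp
    (fun e ↦ Subrepresentation.toSubmodule_injective e)
    (fun e ↦ Subrepresentation.toSubmodule_injective e)

theorem Representation.IsIrreducible.eq_bot_or_eq_top_of_forall {G V : Type*} [Group G]
    [AddCommGroup V] [Module ℂ V] {ρ : Representation ℂ G V} (h : ρ.IsIrreducible)
    (W : Submodule ℂ V) (hW : ∀ g, ∀ v ∈ W, ρ g v ∈ W) : W = ⊥ ∨ W = ⊤ :=
  (h.eq_bot_or_eq_top ⟨W, hW⟩).imp (congrArg Subrepresentation.toSubmodule)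
    (congrArg Subrepresentation.toSubmodule)

/-- Transport of a representation along a linear equivalence. -/
def Representation.transport {G V W : Type*} [Group G] [AddCommGroup V] [Module ℂ V]
    [AddCommGroup W] [Module ℂ W] (ρ : Representation ℂ G V) (e : V ≃ₗ[ℂ] W) :
    Representation ℂ G W where
  toFun g := e.conj (ρ g)
  map_one' := by ext; simp
  map_mul' g h := by ext; simp

@[simp]
theorem Representation.transport_apply {G V W : Type*} [Group G] [AddCommGroup V] [Module ℂ V]
    [AddCommGroup W] [Module ℂ W] (ρ : Representation ℂ G V) (e : V ≃ₗ[ℂ] W) (g : G) (w : W) :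
    ρ.transport e g w = e (ρ g (e.symm w)) :=
  rfl

theorem Representation.character_transport {G V W : Type*} [Group G] [AddCommGroup V] [Module ℂ V]
    [AddCommGroup W] [Module ℂ W] (ρ : Representation ℂ G V) (e : V ≃ₗ[ℂ] W) :
    (ρ.transport e).character = ρ.character := by
  ext g
  exact LinearMap.trace_conj' (ρ g) e

theorem Representation.IsIrreducible.nontrivial {G V : Type*} [Group G] [AddCommGroup V]
    [Module ℂ V] {ρ : Representation ℂ G V} (h : ρ.IsIrreducible) : Nontrivial V := by
  by_contra hV
  rw [not_nontrivial_iff_subsingleton] at hV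
  obtain ⟨a, b, hab⟩ := h.exists_pair_ne
  exact hab (Subrepresentation.toSubmodule_injective (Subsingleton.elim _ _))

theorem Representation.IsIrreducible.transport {G V W : Type*} [Group G] [AddCommGroup V]
    [Module ℂ V] [AddCommGroup W] [Module ℂ W] {ρ : Representation ℂ G V} (h : ρ.IsIrreducible)
    (e : V ≃ₗ[ℂ] W) : (ρ.transport e).IsIrreducible := by
  have := h.nontrivial
  have : Nontrivial W := e.symm.toEquiv.nontrivial
  refine Representation.isIrreducible_of_forall _ fun U hU ↦ ?_
  refine (h.eq_bot_or_eq_top_of_forall (U.comap e.toLinearMap) fun g v hv ↦ ?_).imp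
    (fun hb ↦ ?_) fun ht ↦ ?_
  · simpa using hU g _ hv
  · simpa [Submodule.comap_equiv_eq_map_symm] using hb
  · simpa [Submodule.comap_equiv_eq_map_symm] using ht

theorem trace_eq_add_of_isCompl {V : Type*} [AddCommGroup V] [Module ℂ V] [FiniteDimensional ℂ V]
    (f : V →ₗ[ℂ] V) {U W : Submodule ℂ V} (h : IsCompl U W) (hU : ∀ v ∈ U, f v ∈ U)
    (hW : ∀ v ∈ W, f v ∈ W) :
    LinearMap.trace ℂ V f =
      LinearMap.trace ℂ U (f.restrict hU) + LinearMap.trace ℂ W (f.restrict hW) := by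
  have h1 : f = (f ∘ₗ U.subtype) ∘ₗ U.projectionOnto W h +
      (f ∘ₗ W.subtype) ∘ₗ W.projectionOnto U h.symm := by
    ext v
    simp only [LinearMap.add_apply, LinearMap.comp_apply, Submodule.subtype_apply, ← map_add,
      Submodule.coe_projectionOnto_apply, Submodule.projection_add_projection_eq_self]
  have h2 : f.restrict hU = U.projectionOnto W h ∘ₗ (f ∘ₗ U.subtype) := by
    ext v
    simpa using congrArg Subtype.val
      (Submodule.projectionOnto_apply_left h ⟨f v, hU v v.2⟩).symm
  have h3 : f.restrict hW = W.projectionOnto U h.symm ∘ₗ (f ∘ₗ W.subtype) := by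
    ext v
    simpa using congrArg Subtype.val
      (Submodule.projectionOnto_apply_left h.symm ⟨f v, hW v v.2⟩).symm
  rw [h2, h3, LinearMap.trace_comp_comm' _ (U.projectionOnto W h),
    LinearMap.trace_comp_comm' _ (W.projectionOnto U h.symm), ← map_add, ← h1]

variable {G : Type*} [Group G] [Finite G]

/-- Maschke's theorem, by induction on the dimension: an invariant subspace has an invariant
complement and traces add. -/
theorem character_mem_generalizedCharacters {V : Type*} [AddCommGroup V] [Module ℂ V]
    [FiniteDimensional ℂ V] (ρ : Representation ℂ G V) :
    ρ.character ∈ generalizedCharacters G := by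
  induction hn : Module.finrank ℂ V using Nat.strong_induction_on generalizing V with
  | _ n ih =>
  subst hn
  by_cases hirr : ρ.IsIrreducible
  · refine Submodule.subset_span ⟨_, _, hirr.transport (Module.finBasis ℂ V).equivFun, ?_⟩
    rw [character_transport]
  cases subsingleton_or_nontrivial V with
  | inl hV =>
    convert Submodule.zero_mem (generalizedCharacters G)
    ext g
    simp [Representation.character, Subsingleton.elim (ρ g) 0]
  | inr hV =>
    obtain ⟨W, hW, hb, ht⟩ : ∃ W : Submodule ℂ V, (∀ g, ∀ v ∈ W, ρ g v ∈ W) ∧ W ≠ ⊥ ∧ W ≠ ⊤ := by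
      contrapose! hirr
      exact isIrreducible_of_forall _ fun W hW ↦ or_iff_not_imp_left.2 (hirr W hW)
    have := Fintype.ofFinite G
    have : NeZero (Nat.card G : ℂ) := ⟨by exact_mod_cast Nat.card_pos.ne'⟩
    obtain ⟨W', hc⟩ := exists_isCompl (⟨W, hW⟩ : Subrepresentation ρ)
    have hc' : IsCompl W W'.toSubmodule := by
      constructor
      · rw [disjoint_iff]
        exact congrArg Subrepresentation.toSubmodule hc.inf_eq_bot
      · rw [codisjoint_iff]
        exact congrArg Subrepresentation.toSubmodule hc.sup_eq_top
    have h2 : Module.finrank ℂ W'.toSubmodule < Module.finrank ℂ V := by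
      refine Submodule.finrank_lt fun h ↦ hb ?_
      simpa [h] using hc'.inf_eq_bot
    have key : ρ.character = (Subrepresentation.mk (ρ := ρ) W hW).toRepresentation.character +
        W'.toRepresentation.character := by
      ext g
      exact trace_eq_add_of_isCompl _ hc' (hW g) (W'.apply_mem_toSubmodule g)
    rw [key]
    exact add_mem (ih _ (Submodule.finrank_lt ht) _ rfl) (ih _ h2 _ rfl)

omit [Finite G] in
theorem isClassFunction_of_mem_generalizedCharacters {φ : G → ℂ}
    (hφ : φ ∈ generalizedCharacters G) : IsClassFunction φ := by
  induction hφ using Submodule.span_induction with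
  | mem χ h =>
    obtain ⟨n, ρ, -, rfl⟩ := h
    exact fun g x ↦ ρ.char_conj g x
  | zero => exact fun _ _ ↦ rfl
  | add a b _ _ ha hb => exact fun g x ↦ congrArg₂ (· + ·) (ha g x) (hb g x)
  | smul n a _ ha => exact fun g x ↦ congrArg (n • ·) (ha g x)

theorem one_mem_generalizedCharacters : (1 : G → ℂ) ∈ generalizedCharacters G := by
  convert character_mem_generalizedCharacters (Representation.trivial ℂ G ℂ)
  ext g
  simp [Representation.character]

theorem mul_mem_generalizedCharacters {φ ψ : G → ℂ} (hφ : φ ∈ generalizedCharacters G)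
    (hψ : ψ ∈ generalizedCharacters G) : φ * ψ ∈ generalizedCharacters G := by
  induction hφ, hψ using Submodule.span_induction₂ with
  | mem_mem χ θ h h' =>
    obtain ⟨n, ρ, -, rfl⟩ := h
    obtain ⟨m, σ, -, rfl⟩ := h'
    rw [← char_tensor]
    exact character_mem_generalizedCharacters _
  | zero_left => simp
  | zero_right => simp
  | add_left a b c _ _ _ ha hb => rw [add_mul]; exact add_mem ha hb
  | add_right a b c _ _ _ ha hb => rw [mul_add]; exact add_mem ha hb
  | smul_left n a b _ _ h => rw [smul_mul_assoc]; exact Submodule.smul_mem _ n h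
  | smul_right n a b _ _ h => rw [mul_smul_comm]; exact Submodule.smul_mem _ n h

omit [Finite G] in
theorem comp_mem_generalizedCharacters {H : Type*} [Group H] [Finite H] (j : H →* G) {φ : G → ℂ}
    (hφ : φ ∈ generalizedCharacters G) : φ ∘ j ∈ generalizedCharacters H := by
  induction hφ using Submodule.span_induction with
  | mem χ h =>
    obtain ⟨n, ρ, -, rfl⟩ := h
    exact character_mem_generalizedCharacters (ρ.comp j)
  | zero => exact Submodule.zero_mem _
  | add a b _ _ ha hb => exact add_mem ha hb
  | smul n a _ ha => exact Submodule.smul_mem _ n ha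

theorem finiteDimensional_indV {H V : Type*} [Group H] [AddCommGroup V] [Module ℂ V]
    [FiniteDimensional ℂ V] (j : H →* G) (ρ : Representation ℂ H V) :
    FiniteDimensional ℂ (IndV j ρ) := by
  have : FiniteDimensional ℂ (MonoidAlgebra ℂ G) :=
    (MonoidAlgebra.basis G ℂ).finiteDimensional_of_finite
  infer_instance

theorem inducedFunction_mem_generalizedCharacters {H : Type*} [Group H] [Finite H] (j : H →* G)
    {φ : H → ℂ} (hφ : φ ∈ generalizedCharacters H) :
    inducedFunction j φ ∈ generalizedCharacters G := by
  induction hφ using Submodule.span_induction with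
  | mem χ h =>
    obtain ⟨n, ρ, -, rfl⟩ := h
    rw [← character_ind]
    have := finiteDimensional_indV j ρ
    exact character_mem_generalizedCharacters _
  | zero => rw [map_zero]; exact Submodule.zero_mem _
  | add a b _ _ ha hb => rw [map_add]; exact add_mem ha hb
  | smul n a _ ha => rw [map_zsmul]; exact Submodule.smul_mem _ n ha

/-- Orthonormality of the irreducible characters isolates each coefficient. -/
theorem linearIndependent_irreducibleCharacters :
    LinearIndependent ℂ (Subtype.val : irreducibleCharacters G → (G → ℂ)) := by
  classical
  have := Fintype.ofFinite G
  have : Invertible (Nat.card G : ℂ) :=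
    invertibleOfNonzero (by exact_mod_cast Nat.card_pos.ne')
  have orth : ∀ χ ψ : irreducibleCharacters G,
      (Nat.card G : ℂ)⁻¹ * ∑ g : G, χ.1 g * ψ.1 g⁻¹ = if χ = ψ then 1 else 0 := by
    rintro ⟨_, n, ρ, hρ, rfl⟩ ⟨_, m, σ, hσ, rfl⟩
    split_ifs with h
    · have h' : ρ.character = σ.character := congrArg Subtype.val h
      simp only [← h']
      rw [char_orthonormal ρ ρ, if_pos ⟨Representation.Equiv.refl ρ⟩]
    · rw [char_orthonormal ρ σ, if_neg]
      rintro ⟨e⟩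
      exact h (Subtype.ext (char_iso e).symm)
  rw [linearIndependent_iff']
  intro s c hc ψ hψ
  have h1 : (Nat.card G : ℂ)⁻¹ * ∑ g : G, (∑ χ ∈ s, c χ • χ.1) g * ψ.1 g⁻¹ = 0 := by
    rw [hc]; simp
  have h2 : (Nat.card G : ℂ)⁻¹ * ∑ g : G, (∑ χ ∈ s, c χ • χ.1) g * ψ.1 g⁻¹ =
      ∑ χ ∈ s, c χ * ((Nat.card G : ℂ)⁻¹ * ∑ g : G, χ.1 g * ψ.1 g⁻¹) := by
    simp only [Finset.sum_apply, Pi.smul_apply, smul_eq_mul, Finset.sum_mul, Finset.mul_sum]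
    rw [Finset.sum_comm]
    refine Finset.sum_congr rfl fun χ _ ↦ Finset.sum_congr rfl fun g _ ↦ by ring
  rw [h2] at h1
  simp only [orth] at h1
  simpa [hψ] using h1

end Characters

/-! ### Characters of nilpotent groups are combinations of monomial ones. -/

section Monomial

open Representation

/-- The functions on `G` induced from linear characters of subgroups. -/
def monomialCharacters (G : Type*) [Group G] [Finite G] : Set (G → ℂ) :=
  {ψ | ∃ (F : Subgroup G) (ρ : Representation ℂ F ℂ), ψ = inducedFunction F.subtype ρ.character}

variable {G : Type*} [Group G] [Finite G]

theorem inducedFunction_eq_of_injective {K : Type*} [Group K] [Finite K] (j : K →* G)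
    (hj : Function.Injective j) (ρ : Representation ℂ K ℂ) :
    ∃ σ : Representation ℂ j.range ℂ,
      inducedFunction j ρ.character = inducedFunction j.range.subtype σ.character := by
  let e : K ≃* j.range := MonoidHom.ofInjective hj
  refine ⟨ρ.comp e.symm.toMonoidHom, ?_⟩
  rw [← inducedFunction_mulEquiv e]
  congr 1
  ext k
  simp [Representation.character]

theorem inducedFunction_mem_span_monomialCharacters {H : Type*} [Group H] [Finite H] (j : H →* G)
    (hj : Function.Injective j) {φ : H → ℂ} (hφ : φ ∈ Submodule.span ℤ (monomialCharacters H)) :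
    inducedFunction j φ ∈ Submodule.span ℤ (monomialCharacters G) := by
  induction hφ using Submodule.span_induction with
  | mem χ h =>
    obtain ⟨F, ρ, rfl⟩ := h
    rw [inducedFunction_comp]
    exact Submodule.subset_span ⟨_, inducedFunction_eq_of_injective _
      (by simpa using hj.comp F.subtype_injective) ρ⟩
  | zero => rw [map_zero]; exact Submodule.zero_mem _
  | add a b _ _ ha hb => rw [map_add]; exact add_mem ha hb
  | smul n a _ ha => rw [map_zsmul]; exact Submodule.smul_mem _ n ha

omit [Finite G] in
theorem Representation.IsIrreducible.eq_smul_one {V : Type*} [AddCommGroup V] [Module ℂ V]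
    [FiniteDimensional ℂ V] {ρ : Representation ℂ G V} (h : ρ.IsIrreducible) (f : Module.End ℂ V)
    (hf : ∀ g, f * ρ g = ρ g * f) : ∃ s : ℂ, f = s • 1 := by
  obtain ⟨s, hs⟩ := (IsIrreducible.algebraMap_intertwiningMap_bijective_of_isAlgClosed
    (ρ := ρ)).2 ⟨f, hf⟩
  exact ⟨s, (congrArg IntertwiningMap.toLinearMap hs).symm⟩

/-- If `ρ a` commutes with an irreducible `ρ` up to scalars given by `c`, then `ρ` is induced from
the kernel of `c`. -/
theorem exists_character_eq_inducedFunction_ker {V : Type*} [AddCommGroup V] [Module ℂ V]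
    [FiniteDimensional ℂ V] {ρ : Representation ℂ G V} (hρ : ρ.IsIrreducible) (a : G) (c : G →* ℂ)
    (hc : ∀ g, ρ g * ρ a = c g • (ρ a * ρ g)) :
    ∃ (W : Submodule ℂ V) (σ : Representation ℂ c.ker W),
      ρ.character = inducedFunction c.ker.subtype σ.character := by
  classical
  have := Fintype.ofFinite G
  have := hρ.nontrivial
  obtain ⟨μ, hμ⟩ := Module.End.exists_eigenvalue (ρ a)
  have hμ0 : μ ≠ 0 := by
    rintro rfl
    obtain ⟨v, hv⟩ := hμ.exists_hasEigenvector
    have h1 : ρ a v = 0 := by simpa using hv.apply_eq_smul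
    refine hv.2 ?_
    rw [← Representation.inv_self_apply ρ a v, h1, map_zero]
  set W := Module.End.eigenspace (ρ a) μ
  have hmap : ∀ (g : G) (ν : ℂ) (v : V), v ∈ Module.End.eigenspace (ρ a) ν →
      ρ g v ∈ Module.End.eigenspace (ρ a) ((c g)⁻¹ * ν) := by
    intro g ν v hv
    rw [Module.End.mem_eigenspace_iff] at hv ⊢
    have h1 := LinearMap.congr_fun (hc g) v
    have hcg : c g ≠ 0 := ((Group.isUnit g).map c).ne_zero
    simp only [Module.End.mul_apply, LinearMap.smul_apply, hv, map_smul] at h1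
    rw [mul_smul, h1, smul_smul, inv_mul_cancel₀ hcg, one_smul]
  have hWinv : ∀ g : c.ker, ∀ v ∈ W, ρ g v ∈ W := by
    intro g v hv
    have := hmap g μ v hv
    rwa [show c g = 1 from g.2, inv_one, one_mul] at this
  let σ : Representation ℂ c.ker W :=
    (Subrepresentation.mk (ρ := ρ.comp c.ker.subtype) W hWinv).toRepresentation
  refine ⟨W, σ, ?_⟩
  -- `e` is a projection onto `W` which kills the other eigenspaces
  have hdisj : Disjoint (⨆ ν, ⨆ (_ : ν ≠ μ), Module.End.eigenspace (ρ a) ν) W :=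
    (Module.End.eigenspaces_iSupIndep (ρ a) μ).symm
  obtain ⟨Q, hQ, hWQ⟩ := hdisj.exists_isCompl
  let e : Module.End ℂ V := W.projection Q hWQ.symm
  have heW : ∀ v ∈ W, e v = v := fun v hv ↦ by simp [e, hv]
  have heK : ∀ ν, ν ≠ μ → ∀ v ∈ Module.End.eigenspace (ρ a) ν, e v = 0 := by
    intro ν hν v hv
    have : v ∈ Q := hQ (Submodule.mem_iSup_of_mem ν (Submodule.mem_iSup_of_mem hν hv))
    simp [e, this]
  have hσ : ∀ h : c.ker, σ.character h = LinearMap.trace ℂ V (ρ h * e) := by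
    intro h
    have h1 : σ h = (W.projectionOnto Q hWQ.symm) ∘ₗ (ρ h ∘ₗ W.subtype) := by
      ext v
      simp only [LinearMap.comp_apply, Submodule.coe_projectionOnto_apply]
      exact (heW _ (hWinv h v v.2)).symm
    rw [Representation.character, h1, LinearMap.trace_comp_comm']
    rfl
  -- By Schur this sum of conjugates is a scalar. Testing it on an eigenvector `w ∈ W` gives `|ker
  -- c|`: `ρ y⁻¹ w` stays in `W` for `y ∈ ker c` and otherwise lies in an eigenspace killed by `e`.
  obtain ⟨s, hs⟩ := hρ.eq_smul_one (∑ y : G, ρ y * e * ρ y⁻¹) (fun g ↦ by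
    rw [Finset.sum_mul, Finset.mul_sum]
    refine Fintype.sum_equiv (Equiv.mulLeft g⁻¹) _ _ fun y ↦ ?_
    simp only [Equiv.coe_mulLeft, mul_inv_rev, inv_inv, map_mul, mul_assoc]
    rw [← mul_assoc (ρ g) (ρ g⁻¹), ← map_mul ρ g g⁻¹, mul_inv_cancel, map_one, one_mul])
  have hs' : s = Nat.card c.ker := by
    obtain ⟨w, hw⟩ := hμ.exists_hasEigenvector
    have h1 := LinearMap.congr_fun hs w
    simp only [LinearMap.sum_apply, Module.End.mul_apply, LinearMap.smul_apply,
      Module.End.one_apply] at h1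
    have h2 : ∀ y : G, ρ y (e (ρ y⁻¹ w)) = if y ∈ c.ker then w else 0 := by
      intro y
      split_ifs with hy
      · rw [heW _ (hWinv ⟨y⁻¹, inv_mem hy⟩ w hw.1), Representation.self_inv_apply]
      · rw [heK _ _ _ (hmap y⁻¹ μ w hw.1), map_zero]
        intro h3
        apply hy
        rw [mul_eq_right₀ hμ0, inv_eq_one] at h3
        exact inv_mem_iff.1 h3
    simp only [h2, ← Finset.sum_filter, Finset.sum_const] at h1
    rw [← Nat.cast_smul_eq_nsmul ℂ] at h1
    rw [← smul_left_injective ℂ hw.2 h1, Nat.card_eq_fintype_card, Fintype.card_subtype]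
  ext g
  rw [inducedFunction_apply]
  by_cases hg : g ∈ c.ker
  · have h1 : ∀ y : G, (∑ h : c.ker, if y * c.ker.subtype h * y⁻¹ = g then σ.character h else 0) =
        LinearMap.trace ℂ V (ρ g * (ρ y * e * ρ y⁻¹)) := by
      intro y
      have hm : y⁻¹ * g * y ∈ c.ker := by
        simpa using (inferInstance : c.ker.Normal).conj_mem g hg y⁻¹
      rw [Finset.sum_eq_single ⟨y⁻¹ * g * y, hm⟩]
      · rw [if_pos (by simp; group), hσ]
        simp only [map_mul]
        rw [mul_assoc, mul_assoc, LinearMap.trace_mul_comm]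
        simp only [mul_assoc]
      · intro h _ hh
        rw [if_neg]
        rintro rfl
        apply hh
        ext
        simp; group
      · simp
    simp only [h1]
    rw [← map_sum, ← Finset.mul_sum, hs, hs', mul_smul_comm, mul_one, map_smul, smul_eq_mul,
      inv_mul_cancel_left₀ (by exact_mod_cast Nat.card_pos.ne')]
    rfl
  · have h1 : ∀ y : G, (∑ h : c.ker, if y * c.ker.subtype h * y⁻¹ = g then σ.character h else 0) =
        0 := by
      intro y
      refine Finset.sum_eq_zero fun h _ ↦ if_neg ?_
      rintro rfl
      exact hg ((inferInstance : c.ker.Normal).conj_mem h h.2 y)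
    simp only [h1, Finset.sum_const_zero, mul_zero]
    -- Conjugation by `ρ a` rescales `ρ g` without changing its trace, so the character vanishes
    -- where `c g ≠ 1`.
    have h2 : LinearMap.trace ℂ V (ρ g) = c g • LinearMap.trace ℂ V (ρ g) := by
      rw [← map_smul]
      have h3 : ρ g = c g • (ρ a * (ρ g * ρ a⁻¹)) := by
        rw [← mul_assoc, ← smul_mul_assoc, ← hc, mul_assoc, ← map_mul, mul_inv_cancel, map_one,
          mul_one]
      conv_lhs => rw [h3]
      rw [map_smul, map_smul, LinearMap.trace_mul_comm, mul_assoc, ← map_mul ρ a⁻¹ a,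
        inv_mul_cancel, map_one, mul_one]
    have h4 : (1 - c g) * LinearMap.trace ℂ V (ρ g) = 0 := by
      rw [sub_mul, one_mul, ← smul_eq_mul (c g), ← h2, sub_self]
    refine (mul_eq_zero.1 h4).resolve_left fun h5 ↦ hg ?_
    exact (sub_eq_zero.1 h5).symm

omit [Finite G] in
/-- In a nilpotent group, a proper normal subgroup does not contain all elements that are central
modulo it. -/
theorem exists_notMem_forall_commutator_mem [Group.IsNilpotent G] (Z : Subgroup G) (hZ : Z ≠ ⊤) :
    ∃ a ∉ Z, ∀ g, g * a * g⁻¹ * a⁻¹ ∈ Z := by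
  classical
  have hex : ∃ n, ¬ Subgroup.upperCentralSeries G n ≤ Z := by
    obtain ⟨n, hn⟩ := Group.IsNilpotent.nilpotent G
    exact ⟨n, fun h ↦ hZ (top_le_iff.1 (hn ▸ h))⟩
  -- Take the first term of the upper central series not inside `Z`; it is not the zeroth, which is
  -- trivial.
  obtain ⟨m, hm⟩ : ∃ m, Nat.find hex = m + 1 := Nat.exists_eq_succ_of_ne_zero fun h ↦ by
    have := Nat.find_spec hex
    rw [h] at this
    simp at this
  have h1 : Subgroup.upperCentralSeries G m ≤ Z := not_not.1 (Nat.find_min hex (by omega))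
  have h2 := Nat.find_spec hex
  rw [hm] at h2
  obtain ⟨a, ha, haZ⟩ := SetLike.not_le_iff_exists.1 h2
  refine ⟨a, haZ, fun g ↦ ?_⟩
  rw [Subgroup.mem_upperCentralSeries_succ_iff] at ha
  have := inv_mem (h1 (ha g))
  rwa [commutatorElement_inv] at this

/-- The characters of a finite nilpotent group are integer combinations of functions induced from
linear characters of subgroups. -/
theorem generalizedCharacters_le_span_monomialCharacters (G : Type*) [Group G] [Finite G]
    [Group.IsNilpotent G] :
    generalizedCharacters G ≤ Submodule.span ℤ (monomialCharacters G) := by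
  induction hn : Nat.card G using Nat.strong_induction_on generalizing G with
  | _ n ih =>
  subst hn
  refine Submodule.span_le.2 ?_
  rintro _ ⟨n, ρ, hρ, rfl⟩
  have := hρ.nontrivial
  have hsc : ∀ s t : ℂ, s • (1 : Module.End ℂ (Fin n → ℂ)) = t • 1 → s = t := fun s t h ↦
    smul_left_injective ℂ (one_ne_zero (α := Module.End ℂ (Fin n → ℂ))) h
  -- The elements acting by scalars. If they fill `G`, irreducibility forces dimension one.
  -- Otherwise some `a ∉ Z` is central modulo `Z`, and the scalars of the commutators of `g` with
  -- `a` form a homomorphism `c`. Its kernel is proper, since by Schur `ρ a` would otherwise be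
  -- scalar, so the induction on `|G|` applies to it.
  let Z : Subgroup G :=
    { carrier := {g | ∃ s : ℂ, ρ g = s • 1}
      one_mem' := ⟨1, by simp⟩
      mul_mem' := by
        rintro x y ⟨s, hs⟩ ⟨t, ht⟩
        exact ⟨s * t, by rw [map_mul, hs, ht, smul_mul_smul_comm, mul_one]⟩
      inv_mem' := by
        rintro x ⟨s, hs⟩
        have h1 : s • ρ x⁻¹ = 1 := by
          rw [← one_mul (ρ x⁻¹), ← smul_mul_assoc, ← hs, ← map_mul, mul_inv_cancel, map_one]
        have hs0 : s ≠ 0 := by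
          rintro rfl
          rw [zero_smul] at h1
          exact zero_ne_one h1
        exact ⟨s⁻¹, by rw [← h1, smul_smul, inv_mul_cancel₀ hs0, one_smul]⟩ }
  by_cases hZ : Z = ⊤
  · obtain ⟨v, hv⟩ := exists_ne (0 : Fin n → ℂ)
    have hfin : Module.finrank ℂ (Fin n → ℂ) = 1 := by
      refine (finrank_eq_one_iff_of_nonzero v hv).2 ?_
      refine (hρ.eq_bot_or_eq_top_of_forall _ fun g w hw ↦ ?_).resolve_left ?_
      · obtain ⟨s, hs⟩ : g ∈ Z := hZ ▸ Subgroup.mem_top g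
        rw [hs]
        exact Submodule.smul_mem _ s hw
      · simpa using hv
    let e : (Fin n → ℂ) ≃ₗ[ℂ] ℂ := LinearEquiv.ofFinrankEq _ _ (by simp [hfin])
    obtain ⟨σ, hσ⟩ := inducedFunction_eq_of_injective (MonoidHom.id G) Function.injective_id
      (ρ.transport e)
    rw [inducedFunction_id _ fun g x ↦ char_conj _ g x, character_transport] at hσ
    exact Submodule.subset_span ⟨_, σ, hσ⟩
  · obtain ⟨a, ha, hac⟩ := exists_notMem_forall_commutator_mem Z hZ
    choose s hs using hac
    have hc : ∀ g, ρ g * ρ a = s g • (ρ a * ρ g) := fun g ↦ by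
      rw [← one_mul (ρ a * ρ g), ← smul_mul_assoc, ← hs, ← map_mul, ← map_mul, ← map_mul]
      congr 1
      group
    have hinj : ∀ (g : G) (s t : ℂ), s • (ρ a * ρ g) = t • (ρ a * ρ g) → s = t := by
      intro g s t h
      have h1 := congrArg (· * ρ (a * g)⁻¹) h
      simp only [smul_mul_assoc, ← map_mul, mul_inv_cancel, map_one] at h1
      exact hsc _ _ h1
    let c : G →* ℂ :=
      { toFun := s
        map_one' := hinj 1 _ _ (by rw [← hc]; simp)
        map_mul' := fun g h ↦ hinj (g * h) _ _ (by
          rw [← hc, map_mul, mul_assoc, hc h, mul_smul_comm, ← mul_assoc, hc g, smul_mul_assoc,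
            smul_smul, mul_comm, mul_assoc]) }
    obtain ⟨W, σ, hσ⟩ := exists_character_eq_inducedFunction_ker hρ a c hc
    have hker : c.ker ≠ ⊤ := by
      intro h
      obtain ⟨t, ht⟩ := hρ.eq_smul_one (ρ a) fun g ↦ by
        have hg : c g = 1 := (h ▸ Subgroup.mem_top g : g ∈ c.ker)
        rw [hc g, show s g = 1 from hg, one_smul]
      exact ha ⟨t, ht⟩
    have hcard : Nat.card c.ker < Nat.card G :=
      lt_of_le_of_ne (Subgroup.card_le_card_group _) fun h ↦ hker (Subgroup.eq_top_of_card_eq _ h)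
    rw [SetLike.mem_coe, hσ]
    exact inducedFunction_mem_span_monomialCharacters _ (Subgroup.subtype_injective _)
      (ih _ hcard c.ker rfl (character_mem_generalizedCharacters σ))

end Monomial

/-! ### Elementary subgroups and the local construction at `x` and `p`. -/

section Elementary

/-- An endomorphism of a group `E` which is the projection onto the first factor of a
decomposition of `E` as a product of a cyclic group and a `p`-group, and which is given by powers. -/
structure IsElementaryProjection (p : ℕ) {E : Type*} [Group E] (π : E →* E) : Prop where
  exists_pow : ∀ e, ∃ n : ℕ, π e = e ^ n
  idem : ∀ e, π (π e) = π e
  central : ∀ e x, π e * x = x * π e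
  cyclic : IsCyclic π.range
  pGroup : IsPGroup p π.ker

namespace IsElementaryProjection

variable {p : ℕ} {E : Type*} [Group E] {π : E →* E}

theorem isPElementary (h : IsElementaryProjection p π) : IsPElementary p E := by
  refine ⟨π.range, π.ker, h.cyclic, h.pGroup, ⟨?_, ?_⟩, ?_⟩
  · rw [Subgroup.disjoint_def]
    rintro _ ⟨e, rfl⟩ he
    rw [← h.idem]
    exact he
  · rw [codisjoint_iff, eq_top_iff]
    intro e _
    rw [← mul_inv_cancel_left (π e) e]
    refine mul_mem (Subgroup.mem_sup_left ⟨e, rfl⟩) (Subgroup.mem_sup_right ?_)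
    rw [MonoidHom.mem_ker, map_mul, map_inv, h.idem, inv_mul_cancel]
  · rintro _ ⟨e, rfl⟩ x _
    exact h.central e x

/-- Being given by powers, `π` preserves every subgroup. -/
theorem exists_subgroup (h : IsElementaryProjection p π) (F : Subgroup E) :
    ∃ π' : F →* F, IsElementaryProjection p π' := by
  have hF : ∀ e : F, π e ∈ F := fun e ↦ by
    obtain ⟨n, hn⟩ := h.exists_pow e
    rw [hn]
    exact pow_mem e.2 n
  let π' : F →* F := (π.comp F.subtype).codRestrict F hF
  have hπ' : ∀ e, (π' e : E) = π e := fun e ↦ rfl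
  refine ⟨π', fun e ↦ ?_, fun e ↦ Subtype.ext (h.idem e), fun e x ↦ Subtype.ext (h.central e x),
    ?_, ?_⟩
  · obtain ⟨n, hn⟩ := h.exists_pow e
    exact ⟨n, Subtype.ext hn⟩
  · have := h.cyclic
    let f : π'.range →* π.range := (F.subtype.comp π'.range.subtype).codRestrict π.range (by
      rintro ⟨_, e, rfl⟩
      exact ⟨e, rfl⟩)
    exact isCyclic_of_injective f fun a b hab ↦
      Subtype.ext (Subtype.ext (congrArg (Subtype.val : π.range → E) hab))
  · rintro ⟨e, he⟩
    obtain ⟨k, hk⟩ := h.pGroup ⟨e, congrArg Subtype.val he⟩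
    exact ⟨k, Subtype.ext (Subtype.ext (by simpa using congrArg Subtype.val hk))⟩

/-- The map `e ↦ e * (π e)⁻¹` to the `p`-group `π.ker` has central kernel. -/
theorem isNilpotent [Finite E] [Fact p.Prime] (h : IsElementaryProjection p π) :
    Group.IsNilpotent E := by
  have := h.pGroup.isNilpotent
  let θ : E →* π.ker :=
    { toFun := fun e ↦ ⟨e * (π e)⁻¹, by
        rw [MonoidHom.mem_ker, map_mul, map_inv, h.idem, mul_inv_cancel]⟩
      map_one' := by simp
      map_mul' := fun e f ↦ Subtype.ext (by
        simp only [map_mul, mul_inv_rev, Subgroup.coe_mul]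
        have h1 : (π e)⁻¹ * f = f * (π e)⁻¹ := by rw [← map_inv]; exact h.central _ _
        have h2 : (π e)⁻¹ * (π f)⁻¹ = (π f)⁻¹ * (π e)⁻¹ := by
          rw [← map_inv]; exact h.central _ _
        rw [mul_assoc e (π e)⁻¹, ← mul_assoc (π e)⁻¹, h1, mul_assoc f, h2]
        simp only [mul_assoc]) }
  refine Subgroup.isNilpotent_of_ker_le_center θ (fun e he ↦ ?_)
  have he' : e = π e := mul_inv_eq_one.1 (congrArg Subtype.val he)
  rw [he', Subgroup.mem_center_iff]
  exact fun g ↦ (h.central e g).symm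

theorem mulEquiv (h : IsElementaryProjection p π) {F : Type*} [Group F] (e : E ≃* F) :
    IsElementaryProjection p ((e.toMonoidHom.comp π).comp e.symm.toMonoidHom) where
  exists_pow f := by
    obtain ⟨n, hn⟩ := h.exists_pow (e.symm f)
    exact ⟨n, by simp [hn]⟩
  idem f := by simp [h.idem]
  central f x := e.symm.injective (by simpa using h.central _ _)
  cyclic := by
    have := h.cyclic
    let ι := (e.symm.toMonoidHom.comp (Subgroup.subtype
      ((e.toMonoidHom.comp π).comp e.symm.toMonoidHom).range)).codRestrict π.range (by
        rintro ⟨_, a, rfl⟩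
        exact ⟨e.symm a, (e.symm_apply_apply _).symm⟩)
    exact isCyclic_of_injective ι fun a b hab ↦
      Subtype.ext (e.symm.injective (congrArg (Subtype.val : π.range → E) hab))
  pGroup := by
    rintro ⟨f, hf⟩
    obtain ⟨k, hk⟩ := h.pGroup ⟨e.symm f, e.injective (by simpa using MonoidHom.mem_ker.1 hf)⟩
    have h1 : e.symm (f ^ p ^ k) = e.symm 1 := by
      rw [map_pow, map_one]
      exact congrArg Subtype.val hk
    exact ⟨k, Subtype.ext (e.symm.injective h1)⟩

end IsElementaryProjection

/-- An exponent which computes `p`-regular parts in a finite group. -/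
theorem exists_pow_eq_regular_part (G : Type*) [Group G] [Finite G] (p : ℕ) [hp : Fact p.Prime] :
    ∃ N k : ℕ, (∀ g : G, (g ^ N) ^ N = g ^ N) ∧ (∀ g : G, (g ^ p ^ k) ^ N = g ^ p ^ k) ∧
      ∀ (u : G) (j : ℕ), u ^ p ^ j = 1 → u ^ N = 1 := by
  obtain ⟨k, m, hm, hG⟩ := Nat.exists_eq_pow_mul_and_not_dvd (Nat.card_pos (α := G)).ne' p
    hp.out.ne_one
  have hco : Nat.Coprime p m := (Nat.Prime.coprime_iff_not_dvd hp.out).2 hm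
  -- With `N ≡ 0` modulo `p ^ k` and `N ≡ 1` modulo `m`, the power `g ^ N` kills the `p`-part of `g`
  -- and keeps its regular part.
  obtain ⟨N, hN0, hN1⟩ := Nat.chineseRemainder (hco.pow_left k) 0 1
  have hpow : ∀ (g : G) (a b : ℕ), a ≡ b [MOD p ^ k * m] → g ^ a = g ^ b := by
    intro g a b hab
    exact pow_eq_pow_iff_modEq.2 (hab.of_dvd (hG ▸ orderOf_dvd_natCard g))
  refine ⟨N, k, fun g ↦ ?_, fun g ↦ ?_, fun u j hu ↦ ?_⟩
  · rw [← pow_mul]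
    refine hpow g _ _ ((Nat.modEq_and_modEq_iff_modEq_mul (hco.pow_left k)).1 ⟨?_, ?_⟩)
    · exact (hN0.mul_left N).trans (by simpa using hN0.symm)
    · simpa using hN1.mul_left N
  · rw [← pow_mul]
    refine hpow g _ _ ?_
    simpa using hN1.mul_left' (p ^ k)
  · rw [← orderOf_dvd_iff_pow_eq_one] at hu ⊢
    have h1 : (orderOf u).Coprime m := Nat.Coprime.coprime_dvd_left hu (hco.pow_left j)
    have h2 : orderOf u ∣ p ^ k := h1.dvd_of_dvd_mul_right (hG ▸ orderOf_dvd_natCard u)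
    exact h2.trans ((Nat.modEq_zero_iff_dvd).1 hN0)

open scoped Classical in
-- The induced value is `|π.range|` times the number of cosets in `Z ⧸ E'` fixed by `x`, where `Z`
-- centralizes the regular part of `x`. Both factors are prime to `p`.
theorem exists_isElementaryProjection {G : Type*} [Group G] [Finite G] (x : G) (p : ℕ)
    [hp : Fact p.Prime] :
    ∃ (E : Subgroup G) (π : E →* E) (c : E) (m : ℕ), IsElementaryProjection p π ∧ c ∈ π.range ∧
      ¬ p ∣ m ∧
      inducedFunction E.subtype (fun e ↦ if π e = c then (Nat.card π.range : ℂ) else 0) x = m := by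
  classical
  obtain ⟨N, k, hN, hk, hu⟩ := exists_pow_eq_regular_part G p
  have := Fintype.ofFinite G
  set c := x ^ N with hc
  let Z : Subgroup G := Subgroup.centralizer {c}
  have hcZ : ∀ z ∈ Z, c * z = z * c := fun z hz ↦
    (Subgroup.mem_centralizer_singleton_iff.1 hz).symm
  let c' : Z := ⟨c, Subgroup.mem_centralizer_singleton_iff.2 rfl⟩
  let P : Sylow p Z := default
  have hC : Subgroup.zpowers c' ≤ Subgroup.center Z := by
    rw [Subgroup.zpowers_le, Subgroup.mem_center_iff]
    exact fun z ↦ Subtype.ext (hcZ z z.2).symm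
  have : (Subgroup.zpowers c').Normal := 
    ⟨fun a ha g ↦ by
      rw [Subgroup.mem_center_iff.1 (hC ha) g, mul_inv_cancel_right]
      exact ha⟩
  let E' : Subgroup Z := Subgroup.zpowers c' ⊔ P
  let E : Subgroup G := E'.map Z.subtype
  have hPN : ∀ u ∈ (P : Subgroup Z), u ^ N = 1 := by
    intro u hu'
    obtain ⟨j, hj⟩ := P.isPGroup' ⟨u, hu'⟩
    have h1 : u ^ p ^ j = 1 := by simpa using congrArg Subtype.val hj
    have h2 : (u : G) ^ p ^ j = 1 := by simpa using congrArg Subtype.val h1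
    exact Subtype.ext (by simpa using hu _ _ h2)
  have hcN : c' ^ N = c' := Subtype.ext (hN x)
  have hE' : ∀ e ∈ E', ∃ i : ℤ, ∃ u ∈ (P : Subgroup Z), e = c' ^ i * u ∧ e ^ N = c' ^ i := by
    intro e he
    obtain ⟨a, ha, u, hu', rfl⟩ := Subgroup.mem_sup_of_normal_left.1 he
    obtain ⟨i, rfl⟩ := Subgroup.mem_zpowers_iff.1 ha
    refine ⟨i, u, hu', rfl, ?_⟩
    have hcomm : Commute (c' ^ i) u := ((Subgroup.mem_center_iff.1 (hC ha)) u).symm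
    rw [hcomm.mul_pow, hPN u hu', mul_one, ← zpow_natCast, zpow_comm, zpow_natCast, hcN]
  have hE : ∀ e : E, ∃ i : ℤ, ∃ u ∈ (P : Subgroup Z), (e : G) = c ^ i * u ∧ (e : G) ^ N = c ^ i := by
    rintro ⟨_, e, he, rfl⟩
    obtain ⟨i, u, h1, h2, h3⟩ := hE' e he
    exact ⟨i, u, h1, by simpa using congrArg Subtype.val h2, by simpa using congrArg Subtype.val h3⟩
  have hEZ : E ≤ Z := by
    rintro _ ⟨e, _, rfl⟩
    exact e.2
  have hcomm : ∀ (i : ℤ) (z : Z), Commute (c ^ i) z := fun i z ↦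
    Commute.zpow_left (hcZ z z.2) i
  -- The `N`-th power is multiplicative here: `E` is generated by a Sylow subgroup, which it kills,
  -- and by `c`, which it fixes and which is central in `Z`.
  let π : E →* E :=
    { toFun := fun e ↦ e ^ N
      map_one' := one_pow N
      map_mul' := fun e f ↦ Subtype.ext (by
        obtain ⟨i, u, hu', h1, h2⟩ := hE e
        obtain ⟨j, v, hv', h3, h4⟩ := hE f
        simp only [Subgroup.coe_mul, Subgroup.coe_pow]
        rw [h2, h4, h1, h3, mul_assoc, ← mul_assoc (u : G), ← (hcomm j u).eq, mul_assoc,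
          ← mul_assoc, ← zpow_add]
        have h5 := (hcomm (i + j) (u * v)).mul_pow N
        rw [Subgroup.coe_mul] at h5
        rw [h5, ← Subgroup.coe_mul, ← Subgroup.coe_pow, hPN _ (mul_mem hu' hv')]
        rw [← zpow_natCast, zpow_comm, zpow_natCast, hN, Subgroup.coe_one, mul_one]) }
  have hπ : ∀ e, (π e : G) = (e : G) ^ N := fun e ↦ rfl
  let cE : E := ⟨c, c', Subgroup.mem_sup_left (Subgroup.mem_zpowers c'), rfl⟩
  have hcE : π cE = cE := Subtype.ext (hN x)
  have hproj : IsElementaryProjection p π := by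
    refine ⟨fun e ↦ ⟨N, rfl⟩, fun e ↦ Subtype.ext (hN e), fun e z ↦ Subtype.ext ?_, ?_, ?_⟩
    · obtain ⟨i, u, hu', h1, h2⟩ := hE e
      simp only [Subgroup.coe_mul, hπ, h2]
      exact (hcomm i ⟨z, hEZ z.2⟩).eq
    · refine ⟨⟨cE, cE, hcE⟩, ?_⟩
      rintro ⟨_, e, rfl⟩
      obtain ⟨i, u, hu', h1, h2⟩ := hE e
      exact ⟨i, Subtype.ext (Subtype.ext (by simpa [hπ] using h2.symm))⟩
    · rintro ⟨e, he⟩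
      refine ⟨k, Subtype.ext (Subtype.ext ?_)⟩
      have h1 : (e : G) ^ N = 1 := congrArg Subtype.val he
      simp only [Subgroup.coe_pow, Subgroup.coe_one]
      rw [← hk, pow_right_comm, h1, one_pow]
  have hrange : ¬ p ∣ Nat.card π.range := by
    intro hdvd
    obtain ⟨⟨_, e, rfl⟩, ho⟩ := exists_prime_orderOf_dvd_card' p hdvd
    have h1 : (π e : G) ^ p ^ 1 = 1 := by
      have := pow_orderOf_eq_one (⟨π e, e, rfl⟩ : π.range)
      rw [ho] at this
      simpa using congrArg (fun a : π.range ↦ ((a : E) : G)) this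
    have h2 : π e = 1 := by
      rw [← hproj.idem]
      exact Subtype.ext (hu _ _ h1)
    have h3 : (⟨π e, e, rfl⟩ : π.range) = 1 := Subtype.ext h2
    rw [h3, orderOf_one] at ho
    exact hp.out.one_lt.ne ho
  have hxZ : x ∈ Z := Subgroup.mem_centralizer_singleton_iff.2 (pow_mul_comm' x N).symm
  let x' : Z := ⟨x, hxZ⟩
  let f : Function.End (Z ⧸ E') := MulAction.toEndHom x'
  -- `x ^ p ^ k = c ^ p ^ k` is central in `Z` and lies in `E`, so it acts trivially on the cosets.
  -- The number of fixed points is then congruent modulo `p` to the index of `E'`, which divides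
  -- that of the Sylow subgroup `P`.
  have hf : f ^ p ^ k = 1 := by
    have h1 : x' ^ p ^ k = c' ^ p ^ k := Subtype.ext (by
      simp only [x', c', Subgroup.coe_pow, hc]
      rw [pow_right_comm, hk])
    have h2 : c' ^ p ^ k ∈ Subgroup.zpowers c' := Subgroup.npow_mem_zpowers c' _
    rw [← map_pow, h1]
    funext q
    induction q using QuotientGroup.induction_on with
    | H z =>
      change (((c' ^ p ^ k) * z : Z) : Z ⧸ E') = z
      rw [← Subgroup.mem_center_iff.1 (hC h2) z]
      exact QuotientGroup.mk_mul_of_mem z (Subgroup.mem_sup_left h2)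
  let F : Set (Z ⧸ E') := {q | x' • q = q}
  have hfix : ¬ p ∣ Nat.card F := by
    intro h
    have h1 := Equiv.Perm.card_fixedPoints_modEq hf
    rw [@Fintype.card_eq_nat_card _ (_), @Fintype.card_eq_nat_card _ (_)] at h1
    have h2 := (h1.trans ((Nat.modEq_zero_iff_dvd).2 h))
    rw [Nat.modEq_zero_iff_dvd] at h2
    exact P.not_dvd_index (h2.trans (Subgroup.index_dvd_of_le le_sup_right))
  have hmemE : ∀ z : Z, (z : G) ∈ E ↔ z ∈ E' := fun z ↦
    Subgroup.mem_map_iff_mem Z.subtype_injective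
  have hcount : Nat.card {y : G // y ∈ Z ∧ y⁻¹ * x * y ∈ E} =
      Nat.card E * Nat.card F := by
    have h1 : Nat.card E = Nat.card E' :=
      (Nat.card_congr (E'.equivMapOfInjective _ Z.subtype_injective).toEquiv).symm
    rw [h1, ← Nat.card_prod]
    refine Nat.card_congr (Equiv.trans ?_ (QuotientGroup.preimageMkEquivSubgroupProdSet E'
      F))
    have h2 : ∀ z : Z, z ∈ (QuotientGroup.mk ⁻¹' F : Set Z) ↔
        (z : G)⁻¹ * x * z ∈ E := by
      intro z
      change ((x' * z : Z) : Z ⧸ E') = z ↔ _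
      rw [eq_comm, QuotientGroup.eq, ← mul_assoc, ← hmemE]
      rfl
    exact
      { toFun := fun y ↦ ⟨⟨y.1, y.2.1⟩, (h2 _).2 y.2.2⟩
        invFun := fun z ↦ ⟨z.1, z.1.2, (h2 _).1 z.2⟩
        left_inv := fun y ↦ rfl
        right_inv := fun z ↦ rfl }
  refine ⟨E, π, cE, Nat.card π.range * Nat.card F, hproj, ⟨cE, hcE⟩,
    hp.out.not_dvd_mul hrange hfix, ?_⟩
  -- The regular part of `y⁻¹ * x * y` is `y⁻¹ * c * y`, which equals `c` exactly when `y ∈ Z`.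
  have hsum : ∀ y : G, (∑ e : E, if y * E.subtype e * y⁻¹ = x then
      (if π e = cE then (Nat.card π.range : ℂ) else 0) else 0) =
      if y ∈ Z ∧ y⁻¹ * x * y ∈ E then (Nat.card π.range : ℂ) else 0 := by
    intro y
    by_cases hy : y⁻¹ * x * y ∈ E
    · rw [Finset.sum_eq_single ⟨y⁻¹ * x * y, hy⟩]
      · rw [if_pos (by simp; group)]
        refine if_congr ?_ rfl rfl
        rw [and_iff_left hy, Subtype.ext_iff, hπ, Subgroup.mem_centralizer_singleton_iff]
        have h1 : (y⁻¹ * x * y) ^ N = y⁻¹ * c * y := by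
          simpa using (conj_pow (a := y⁻¹) (b := x) (i := N))
        simp only [h1, cE]
        rw [mul_assoc, inv_mul_eq_iff_eq_mul, eq_comm]
      · intro e _ he
        rw [if_neg]
        rintro h1
        apply he
        ext
        simp only [← h1, Subgroup.subtype_apply]
        group
      · simp
    · rw [if_neg (fun h ↦ hy h.2)]
      refine Finset.sum_eq_zero fun e _ ↦ if_neg fun h1 ↦ hy ?_
      have : y⁻¹ * x * y = e := by
        simp only [← h1, Subgroup.subtype_apply]
        group
      rw [this]
      exact e.2
  rw [inducedFunction_apply, Finset.sum_congr rfl fun y _ ↦ hsum y]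
  rw [← Finset.sum_filter, Finset.sum_const, ← Fintype.card_subtype, ← Nat.card_eq_fintype_card,
    hcount, nsmul_eq_mul, Nat.cast_mul, Nat.cast_mul, mul_assoc,
    inv_mul_cancel_left₀ (by exact_mod_cast Nat.card_pos.ne'), mul_comm]

end Elementary

/-! ### Cyclotomic coefficients and descent to `ℤ`. -/

section CoefficientRing

/-- There is a ring of cyclotomic integers containing the `n`-th roots of unity which retracts
linearly onto `ℤ`. -/
theorem exists_subalgebra_rootsOfUnity (n : ℕ) (hn : n ≠ 0) :
    ∃ A : Subalgebra ℤ ℂ, (∀ z : ℂ, z ^ n = 1 → z ∈ A) ∧ ∃ t : A →ₗ[ℤ] ℤ, t 1 = 1 := by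
  have : NeZero n := ⟨hn⟩
  have hζ := Complex.isPrimitiveRoot_exp n hn
  set ζ := Complex.exp (2 * Real.pi * Complex.I / n)
  have hint : IsIntegral ℤ ζ := hζ.isIntegral (Nat.pos_of_ne_zero hn)
  refine ⟨Algebra.adjoin ℤ {ζ}, fun z hz ↦ ?_, ?_⟩
  · obtain ⟨i, -, rfl⟩ := hζ.eq_pow_of_pow_eq_one hz
    exact pow_mem (Algebra.self_mem_adjoin_singleton ℤ ζ) i
  -- The retraction is the coordinate along `1` in the power basis of `ℤ[ζ]`.
  · let b := Algebra.adjoin.powerBasis' hint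
    have hb : b.basis ⟨0, b.dim_pos⟩ = 1 := by simp
    refine ⟨b.basis.coord ⟨0, b.dim_pos⟩, ?_⟩
    rw [← hb, Module.Basis.coord_apply, Module.Basis.repr_self, Finsupp.single_eq_same]

variable {G : Type*} [Group G] [Finite G] (A : Subalgebra ℤ ℂ)

/-- Integer combinations can be recovered from combinations of generalized characters with
coefficients in a ring that retracts onto `ℤ`. -/
theorem one_mem_span_int (t : A →ₗ[ℤ] ℤ) (ht : t 1 = 1) {S : Set (G → ℂ)}
    (hS : ∀ f ∈ S, f ∈ generalizedCharacters G) (h1 : (1 : G → ℂ) ∈ Submodule.span A S) :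
    (1 : G → ℂ) ∈ Submodule.span ℤ S := by
  let b : irreducibleCharacters G → (G → ℂ) := Subtype.val
  have hb : LinearIndependent A b :=
    linearIndependent_irreducibleCharacters.restrict_scalars fun x y h ↦
      Subtype.ext (by simpa [Algebra.smul_def] using h)
  let Φ := Finsupp.linearCombination A b
  -- `T` applies the retraction to the coefficients. It sends `A`-combinations of `S` into the
  -- `ℤ`-span of `S`, because elements of `S` have integer coefficients.
  let T : (irreducibleCharacters G →₀ A) →ₗ[ℤ] (G → ℂ) :=
    Finsupp.linearCombination ℤ b ∘ₗ Finsupp.mapRange.linearMap t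
  have key : ∀ v ∈ generalizedCharacters G, ∀ a : A, ∃ l, Φ l = a • v ∧ T l = t a • v := by
    intro v hv a
    induction hv using Submodule.span_induction with
    | mem χ h => exact ⟨Finsupp.single ⟨χ, h⟩ a, by simp [Φ, b], by simp [T, b]⟩
    | zero => exact ⟨0, by simp, by simp⟩
    | add v w _ _ hv hw =>
      obtain ⟨l, h1, h2⟩ := hv
      obtain ⟨l', h3, h4⟩ := hw
      exact ⟨l + l', by rw [map_add, h1, h3, smul_add], by rw [map_add, h2, h4, smul_add]⟩
    | smul n v _ hv =>
      obtain ⟨l, h1, h2⟩ := hv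
      exact ⟨n • l, by rw [map_zsmul, h1, smul_comm], by rw [map_zsmul, h2, smul_comm]⟩
  have key2 : ∀ f ∈ Submodule.span A S, ∀ a : A,
      ∃ l, Φ l = a • f ∧ T l ∈ Submodule.span ℤ S := by
    intro f hf
    induction hf using Submodule.span_induction with
    | mem f h =>
      intro a
      obtain ⟨l, h1, h2⟩ := key f (hS f h) a
      exact ⟨l, h1, h2 ▸ Submodule.smul_mem _ _ (Submodule.subset_span h)⟩
    | zero => exact fun a ↦ ⟨0, by simp, by simp⟩
    | add v w _ _ hv hw =>
      intro a
      obtain ⟨l, h1, h2⟩ := hv a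
      obtain ⟨l', h3, h4⟩ := hw a
      exact ⟨l + l', by rw [map_add, h1, h3, smul_add], by rw [map_add]; exact add_mem h2 h4⟩
    | smul c v _ hv =>
      intro a
      obtain ⟨l, h1, h2⟩ := hv (a * c)
      exact ⟨l, by rw [h1, mul_smul], h2⟩
  obtain ⟨l, h2, h3⟩ := key2 1 h1 1
  obtain ⟨l', h4, h5⟩ := key 1 one_mem_generalizedCharacters 1
  have hl : l = l' := hb (h2.trans h4.symm)
  rw [hl, h5, ht, one_smul] at h3
  exact h3

theorem monoidHom_mem_generalizedCharacters (χ : G →* ℂ) :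
    (χ : G → ℂ) ∈ generalizedCharacters G := by
  let ρ : Representation ℂ G ℂ := (Algebra.lmul ℂ ℂ : ℂ →* Module.End ℂ ℂ).comp χ
  convert character_mem_generalizedCharacters ρ
  ext g
  exact (Algebra.trace_self_apply (χ g)).symm

open scoped Classical in
-- Orthogonality on the abelian group `π.range`: the function is the sum over its characters `ψ` of
-- `ψ (c⁻¹) * ψ (π e)`, and each `ψ (c⁻¹)` is a root of unity in `A`.
theorem indicator_mem_span_generalizedCharacters (hA : ∀ z : ℂ, z ^ Nat.card G = 1 → z ∈ A)
    (π : G →* G) (hπ : ∀ e x, π e * x = x * π e) (c : G) (hc : c ∈ π.range) :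
    (fun e ↦ if π e = c then (Nat.card π.range : ℂ) else 0) ∈
      Submodule.span A (generalizedCharacters G : Set (G → ℂ)) := by
  have := Fintype.ofFinite G
  let : CommGroup π.range :=
    { (inferInstance : Group π.range) with
      mul_comm := by
        rintro ⟨_, e, rfl⟩ y
        exact Subtype.ext (hπ e y) }
  let c' : π.range := ⟨c, hc⟩
  have h1 : (fun e ↦ if π e = c then (Nat.card π.range : ℂ) else 0) =
      ∑ ψ : AddChar (Additive π.range) ℂ,
        (fun e ↦ ψ (Additive.ofMul c'⁻¹) * ψ (Additive.ofMul (π.rangeRestrict e))) := by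
    ext e
    simp only [Finset.sum_apply, ← AddChar.map_add_eq_mul]
    rw [AddChar.sum_apply_eq_ite, Nat.card_eq_fintype_card]
    refine if_congr ?_ (by rw [Fintype.card_congr Additive.ofMul]) rfl
    rw [← ofMul_mul, ofMul_eq_zero, inv_mul_eq_one, eq_comm, Subtype.ext_iff]
    rfl
  rw [h1]
  refine Submodule.sum_mem _ fun ψ _ ↦ ?_
  have h2 : ψ (Additive.ofMul c'⁻¹) ∈ A := by
    refine hA _ ?_
    rw [← AddChar.map_nsmul_eq_pow, ← ofMul_pow]
    have : c'⁻¹ ^ Nat.card G = 1 := Subtype.ext (by simp)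
    rw [this, ofMul_one, AddChar.map_zero_eq_one]
  let χ : G →* ℂ :=
    { toFun := fun e ↦ ψ (Additive.ofMul (π.rangeRestrict e))
      map_one' := by simp
      map_mul' := fun e f ↦ by rw [map_mul, ofMul_mul, AddChar.map_add_eq_mul] }
  exact Submodule.smul_mem _ (⟨_, h2⟩ : A) (Submodule.subset_span
    (monoidHom_mem_generalizedCharacters χ))

end CoefficientRing

/-! ### Brauer's induction theorem. -/

section Brauer

/-- The functions on `G` induced from generalized characters of elementary subgroups. -/
def elementaryInducedFunctions (G : Type*) [Group G] [Finite G] : Set (G → ℂ) :=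
  {f | ∃ (p : ℕ) (E : Subgroup G) (π : E →* E), p.Prime ∧ IsElementaryProjection p π ∧
    ∃ θ ∈ generalizedCharacters E, f = inducedFunction E.subtype θ}

variable {G : Type*} [Group G] [Finite G]

theorem elementaryInducedFunctions_subset :
    ∀ f ∈ elementaryInducedFunctions G, f ∈ generalizedCharacters G := by
  rintro _ ⟨p, E, π, -, -, θ, hθ, rfl⟩
  exact inducedFunction_mem_generalizedCharacters _ hθ

/-- By the projection formula, a product of two generators is again induced from an elementary
subgroup. -/
theorem mul_mem_span_elementaryInducedFunctions (A : Subalgebra ℤ ℂ) {f g : G → ℂ}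
    (hf : f ∈ Submodule.span A (elementaryInducedFunctions G))
    (hg : g ∈ Submodule.span A (elementaryInducedFunctions G)) :
    f * g ∈ Submodule.span A (elementaryInducedFunctions G) := by
  induction hf, hg using Submodule.span_induction₂ with
  | mem_mem f g hf hg =>
    have hf' := elementaryInducedFunctions_subset f hf
    obtain ⟨p, E, π, hp, hπ, θ, hθ, rfl⟩ := hg
    rw [mul_inducedFunction _ _ (isClassFunction_of_mem_generalizedCharacters hf')]
    exact Submodule.subset_span ⟨p, E, π, hp, hπ, _, mul_mem_generalizedCharacters
      (comp_mem_generalizedCharacters _ hf') hθ, rfl⟩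
  | zero_left => simp
  | zero_right => simp
  | add_left a b c _ _ _ ha hb => rw [add_mul]; exact add_mem ha hb
  | add_right a b c _ _ _ ha hb => rw [mul_add]; exact add_mem ha hb
  | smul_left n a b _ _ h => rw [smul_mul_assoc]; exact Submodule.smul_mem _ n h
  | smul_right n a b _ _ h => rw [mul_smul_comm]; exact Submodule.smul_mem _ n h

theorem exists_mem_span_apply_not_dvd (A : Subalgebra ℤ ℂ)
    (hA : ∀ z : ℂ, z ^ Nat.card G = 1 → z ∈ A) (x : G) (p : ℕ) [hp : Fact p.Prime] :
    ∃ f ∈ Submodule.span A (elementaryInducedFunctions G), ∃ m : ℕ, ¬ p ∣ m ∧ f x = m := by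
  obtain ⟨E, π, c, m, hπ, hc, hm, h⟩ := exists_isElementaryProjection x p
  have key : ∀ ψ ∈ Submodule.span A (generalizedCharacters E : Set (E → ℂ)),
      inducedFunction E.subtype ψ ∈ Submodule.span A (elementaryInducedFunctions G) := by
    intro ψ hψ
    induction hψ using Submodule.span_induction with
    | mem θ hθ => exact Submodule.subset_span ⟨p, E, π, hp.out, hπ, θ, hθ, rfl⟩
    | zero => rw [map_zero]; exact Submodule.zero_mem _
    | add a b _ _ ha hb => rw [map_add]; exact add_mem ha hb
    | smul a f _ hf =>
      rw [show a • f = (a : ℂ) • f from rfl, map_smul]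
      exact Submodule.smul_mem _ a hf
  refine ⟨_, key _ (indicator_mem_span_generalizedCharacters A (fun z hz ↦ hA z ?_) π hπ.central
    c hc), m, hm, by convert h⟩
  obtain ⟨k, hk⟩ := Subgroup.card_subgroup_dvd_card E
  rw [hk, pow_mul, hz, one_pow]

/-- The integers attained at `x` form an ideal of `ℤ` which no prime divides. -/
theorem exists_mem_span_apply_eq_one (A : Subalgebra ℤ ℂ)
    (hA : ∀ z : ℂ, z ^ Nat.card G = 1 → z ∈ A) (x : G) :
    ∃ f ∈ Submodule.span A (elementaryInducedFunctions G), f x = 1 := by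
  let J : Submodule ℤ ℤ :=
    { carrier := {n | ∃ f ∈ Submodule.span A (elementaryInducedFunctions G), f x = n}
      add_mem' := by
        rintro a b ⟨f, hf, hfa⟩ ⟨g, hg, hgb⟩
        exact ⟨f + g, add_mem hf hg, by simp [hfa, hgb]⟩
      zero_mem' := ⟨0, Submodule.zero_mem _, by simp⟩
      smul_mem' := by
        rintro n a ⟨f, hf, hfa⟩
        exact ⟨n • f, zsmul_mem hf n, by simp [hfa]⟩ }
  obtain ⟨d, hd⟩ := (inferInstance : J.IsPrincipal).principal
  have hd1 : d.natAbs = 1 := by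
    by_contra h
    obtain ⟨p, hp, hpd⟩ := Nat.exists_prime_and_dvd h
    have : Fact p.Prime := ⟨hp⟩
    obtain ⟨f, hf, m, hm, hfm⟩ := exists_mem_span_apply_not_dvd A hA x p
    have hmJ : (m : ℤ) ∈ J := ⟨f, hf, by simp [hfm]⟩
    rw [hd, Submodule.mem_span_singleton] at hmJ
    obtain ⟨a, ha⟩ := hmJ
    exact hm (Int.natCast_dvd_natCast.1 ((Int.natCast_dvd.2 hpd).trans ⟨a, by
      rw [← ha, smul_eq_mul, mul_comm]⟩))
  have h1 : (1 : ℤ) ∈ J := by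
    rw [hd, Submodule.mem_span_singleton]
    rcases Int.natAbs_eq_iff.1 hd1 with h | h
    · exact ⟨1, by simp [h]⟩
    · exact ⟨-1, by simp [h]⟩
  obtain ⟨f, hf, hfx⟩ := h1
  exact ⟨f, hf, by simpa using hfx⟩

/-- Brauer's induction theorem for the trivial character. -/
theorem one_mem_span_elementaryInducedFunctions :
    (1 : G → ℂ) ∈ Submodule.span ℤ (elementaryInducedFunctions G) := by
  classical
  have := Fintype.ofFinite G
  obtain ⟨A, hA, t, ht⟩ := exists_subalgebra_rootsOfUnity (Nat.card G) Nat.card_pos.ne'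
  refine one_mem_span_int A t ht elementaryInducedFunctions_subset ?_
  have h : ∀ s : Finset G, ∃ f ∈ Submodule.span A (elementaryInducedFunctions G),
      ∀ x ∈ s, f x = 1 := by
    intro s
    induction s using Finset.induction_on with
    | empty => exact ⟨0, Submodule.zero_mem _, by simp⟩
    | insert a s _ ih =>
      obtain ⟨f, hf, hfs⟩ := ih
      obtain ⟨g, hg, hga⟩ := exists_mem_span_apply_eq_one A hA a
      -- This is `1 - (1 - f) * (1 - g)`, equal to `1` wherever `f` or `g` is.
      refine ⟨f + g - f * g, sub_mem (add_mem hf hg)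
        (mul_mem_span_elementaryInducedFunctions A hf hg), fun x hx ↦ ?_⟩
      rcases Finset.mem_insert.1 hx with rfl | hx
      · simp [hga]
      · simp [hfs x hx]
  obtain ⟨f, hf, hf1⟩ := h Finset.univ
  rwa [show f = 1 from funext fun x ↦ hf1 x (Finset.mem_univ x)] at hf

theorem IsElementaryProjection.inducedFunction_mem_span {p : ℕ} [hp : Fact p.Prime]
    {E : Subgroup G} {π : E →* E} (h : IsElementaryProjection p π) {θ : E → ℂ}
    (hθ : θ ∈ generalizedCharacters E) :
    inducedFunction E.subtype θ ∈ Submodule.span ℤ (elementaryMonomialCharacters G) := by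
  have := h.isNilpotent
  have hθ' := generalizedCharacters_le_span_monomialCharacters E hθ
  clear hθ
  induction hθ' using Submodule.span_induction with
  | mem χ hχ =>
    obtain ⟨F, ρ, rfl⟩ := hχ
    obtain ⟨π', hπ'⟩ := h.exists_subgroup F
    have hinj : Function.Injective (E.subtype.comp F.subtype) := by
      simp
    obtain ⟨σ, hσ⟩ := inducedFunction_eq_of_injective _ hinj ρ
    rw [inducedFunction_comp, hσ]
    exact Submodule.subset_span ⟨_, σ, ⟨p, hp.out,
      (hπ'.mulEquiv (MonoidHom.ofInjective hinj)).isPElementary⟩, (character_ind _ σ).symm⟩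
  | zero => rw [map_zero]; exact Submodule.zero_mem _
  | add a b _ _ ha hb => rw [map_add]; exact add_mem ha hb
  | smul n a _ ha => rw [map_zsmul]; exact Submodule.smul_mem _ n ha

end Brauer

theorem mainTheorem3 {G : Type*} [Group G] [Finite G] (φ : G → ℂ) (hφ : IsClassFunction φ) :
    List.TFAE [
      φ ∈ generalizedCharacters G,
      ∀ E : Subgroup G, IsBrauerElementary E → (fun e : E => φ e) ∈ generalizedCharacters E,
      φ ∈ Submodule.span ℤ (elementaryMonomialCharacters G)] := by
  tfae_have 1 → 2 := fun h E _ ↦ comp_mem_generalizedCharacters E.subtype h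
  tfae_have 2 → 3 := by
    intro h
    -- Only the factor `1` is expanded; the hypothesis on `φ` enters through the projection formula
    -- on each generator.
    rw [← mul_one φ]
    have h1 := one_mem_span_elementaryInducedFunctions (G := G)
    generalize (1 : G → ℂ) = ψ at h1 ⊢
    induction h1 using Submodule.span_induction with
    | mem f hf =>
      obtain ⟨p, E, π, hp, hπ, θ, hθ, rfl⟩ := hf
      have : Fact p.Prime := ⟨hp⟩
      rw [mul_inducedFunction _ _ hφ]
      exact hπ.inducedFunction_mem_span (mul_mem_generalizedCharacters
        (h E ⟨p, hp, hπ.isPElementary⟩) hθ)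
    | zero => rw [mul_zero]; exact Submodule.zero_mem _
    | add a b _ _ ha hb => rw [mul_add]; exact add_mem ha hb
    | smul n a _ ha => rw [mul_smul_comm]; exact Submodule.smul_mem _ n ha
  tfae_have 3 → 1 := by
    intro h
    refine (Submodule.span_le.2 ?_ : _ ≤ generalizedCharacters G) h
    rintro _ ⟨E, ρ, -, rfl⟩
    have := finiteDimensional_indV E.subtype ρ
    exact character_mem_generalizedCharacters _
  tfae_finish
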